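/- Conventions. Algebras are associative and need not have a unit. A normed field of characteristic zero is a field $\mathbb F$ of characteristic zero with a map $|\cdot|:\mathbb F\to[0,\infty)$ such that, for all $\lambda,\mu\in\mathbb F$ and $n\in\mathbb N$: $|\lambda|=0$ if and only if $\lambda=0$, $|\lambda+\mu|\le|\lambda|+|\mu|$, $|-\lambda|=|\lambda|$, $|\lambda\mu|\le|\lambda||\mu|$, and $|n\cdot\lambda|=n|\lambda|$. A metric $\mathbb F$-algebra is an $\mathbb F$-algebra $\mathfrak A$ with a metric $d$ for which there is a real $\gamma>0$ such that, for all $a,b,c\in\mathfrak A$ and $\lambda\in\mathbb F$: $$d(a+c,b+c)\le\gamma\, d(a,b),\qquad d(\lambda a,\lambda b)\le\gamma|\lambda|\,d(a,b),$$ $$d(ac,bc)\le\gamma\, d(c,0)\,d(a,b),\qquad d(ca,cb)\le\gamma\, d(c,0)\,d(a,b).$$ Its completion $C(\mathfrak A)$ is its completion as a metric space, with the operations extended by continuity. For a monoid $\mathsf S$ with neutral element $e$, a finite $\mathsf S$-grading on $\mathfrak A$ is a decomposition $\mathfrak A=\bigoplus_{\xi\in\mathsf S}\mathfrak A_\xi$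 into $\mathbb F$-subspaces with $\mathfrak A_\xi\mathfrak A_\zeta\subseteq\mathfrak A_{\xi\zeta}$ for all $\xi,\zeta\in\mathsf S$ and with $\mathfrak A_\xi\ne0$ for only finitely many $\xi$. The component $\mathfrak A_e$ is then a subalgebra, and it is a metric $\mathbb F$-algebra for the metric induced from $\mathfrak A$. An algebra is nil if each of its elements $a$ satisfies $a^n=0$ for some $n\ge1$ (depending on $a$), and nilpotent if, for some $n\ge1$, every product of $n$ of its elements is $0$. Corollary. Let $\mathbb F$ be a normed field of characteristic zero, $\mathsf S$ a cancellative monoid, and $\mathfrak A$ a metric $\mathbb F$-algebra with a finite $\mathsf S$-grading. If the completion $C(\mathfrak A_e)$ is nil, then $\mathfrak A$ is nilpotent. -/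

import Mathlib

/-! Normed fields, metric algebras and their completions, gradings, nil and nilpotent algebras.
Algebras are associative and need not have a unit: an `F`-algebra is a `NonUnitalRing` that is an
`F`-module with `IsScalarTower F A A` and `SMulCommClass F A A`. -/

/-- The norm `ν` makes the field `F` a normed field. A `RingNorm` is a norm on the additive group,
invariant under negation, vanishing only at `0` and submultiplicative (multiplicativity is not
required). In characteristic zero one also asks for `|n • x| = n * |x|`. -/
structure IsNormedFieldNorm {F : Type*} [Field F] (ν : RingNorm F) : Prop where
  natCast_mul : CharZero F → ∀ (n : ℕ) (x : F), ν (n • x) = n * ν x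

/-- The metric of `A` makes the algebra `A` a metric algebra over the field `F` normed by `ν`. -/
structure IsMetricAlgebra {F : Type*} [Field F] (ν : RingNorm F)
    (A : Type*) [NonUnitalRing A] [Module F A] [MetricSpace A] : Prop where
  exists_const : ∃ γ : ℝ, 0 < γ ∧
    (∀ a b c : A, dist (a + c) (b + c) ≤ γ * dist a b) ∧
    (∀ (r : F) (a b : A), dist (r • a) (r • b) ≤ γ * ν r * dist a b) ∧
    (∀ a b c : A, dist (a * c) (b * c) ≤ γ * dist c 0 * dist a b) ∧
    (∀ a b c : A, dist (c * a) (c * b) ≤ γ * dist c 0 * dist a b)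

/-- The product `a 0 * a 1 * ⋯ * a n` of `n + 1` factors. -/
def seqProd {A : Type*} [Mul A] (a : ℕ → A) : ℕ → A
  | 0 => a 0
  | n + 1 => seqProd a n * a (n + 1)

/-- Every element `a` has a vanishing power `a ^ (n + 1)`. -/
def IsNilAlgebra (A : Type*) [NonUnitalRing A] : Prop :=
  ∀ a : A, ∃ n : ℕ, seqProd (fun _ => a) n = 0

/-- For some `n`, every product of `n + 1` elements vanishes. -/
def IsNilpotentAlgebra (A : Type*) [NonUnitalRing A] : Prop :=
  ∃ n : ℕ, ∀ a : ℕ → A, seqProd a n = 0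

/-- The family `𝒜` of subspaces is an `S`-grading of the algebra `A`. -/
structure IsGrading {F S A : Type*} [Field F] [Monoid S] [NonUnitalRing A] [Module F A]
    (𝒜 : S → Submodule F A) : Prop where
  isInternal : letI := Classical.decEq S; DirectSum.IsInternal 𝒜
  mul_mem : ∀ (s t : S) (a b : A), a ∈ 𝒜 s → b ∈ 𝒜 t → a * b ∈ 𝒜 (s * t)

/-- The neutral component `A_e` of a grading, as a subalgebra of `A`. -/
def IsGrading.neutral {F S A : Type*} [Field F] [Monoid S] [NonUnitalRing A] [Module F A]
    {𝒜 : S → Submodule F A} (h : IsGrading 𝒜) : NonUnitalSubalgebra F A where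
  carrier := 𝒜 1
  add_mem' := (𝒜 1).add_mem
  zero_mem' := (𝒜 1).zero_mem
  smul_mem' r _ ha := (𝒜 1).smul_mem r ha
  mul_mem' {a b} ha hb := by simpa using h.mul_mem 1 1 a b ha hb

namespace IsMetricAlgebra

variable {F : Type*} [Field F] {ν : RingNorm F}
  {A : Type*} [NonUnitalRing A] [Module F A] [MetricSpace A]

/-- A subalgebra of a metric algebra is a metric algebra for the induced metric. -/
theorem subalgebra (h : IsMetricAlgebra ν A) (B : NonUnitalSubalgebra F A) :
    IsMetricAlgebra ν B := by
  obtain ⟨γ, h0, h1, h2, h3, h4⟩ := h.exists_const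
  exact ⟨γ, h0, fun a b c => h1 a b c, fun r a b => h2 r a b, fun a b c => h3 a b c,
    fun a b c => h4 a b c⟩

theorem isUniformAddGroup (h : IsMetricAlgebra ν A) : IsUniformAddGroup A := by
  obtain ⟨γ, h0, h1, -⟩ := h.exists_const
  have h1' : ∀ a b c : A, dist (c + a) (c + b) ≤ γ * dist a b := fun a b c => by
    simpa [add_comm] using h1 a b c
  have hneg : ∀ a b : A, dist (-a) (-b) ≤ γ * dist a b := fun a b => by
    have := h1 b a (-a - b)
    rw [dist_comm b a] at this
    convert this using 2 <;> abel
  refine ⟨Metric.uniformContinuous_iff.2 fun ε hε => ?_⟩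
  refine ⟨ε / (γ + γ * γ), by positivity, fun {p q} hpq => ?_⟩
  have hp : dist p.1 q.1 ≤ dist p q := le_max_left _ _
  have hq : dist p.2 q.2 ≤ dist p q := le_max_right _ _
  rw [lt_div_iff₀ (by positivity)] at hpq
  calc dist (p.1 - p.2) (q.1 - q.2)
      ≤ dist (p.1 + -p.2) (q.1 + -p.2) + dist (q.1 + -p.2) (q.1 + -q.2) := by
        simpa [sub_eq_add_neg] using dist_triangle (p.1 - p.2) (q.1 - p.2) (q.1 - q.2)
    _ ≤ γ * dist p q + γ * (γ * dist p q) := by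
        refine add_le_add ((h1 _ _ _).trans (by gcongr)) ((h1' _ _ _).trans ?_)
        have := hneg p.2 q.2
        gcongr
        exact this.trans (by gcongr)
    _ = dist p q * (γ + γ * γ) := by ring
    _ < ε := hpq

theorem continuousMul (h : IsMetricAlgebra ν A) : ContinuousMul A := by
  obtain ⟨γ, h0, -, -, h3, h4⟩ := h.exists_const
  refine ⟨continuous_iff_continuousAt.2 fun p => ?_⟩
  rw [ContinuousAt, tendsto_iff_dist_tendsto_zero]
  have hlim : Filter.Tendsto (fun q : A × A => γ * dist q.2 0 * dist q.1 p.1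
      + γ * dist p.1 0 * dist q.2 p.2) (nhds p) (nhds 0) := by
    have : Continuous (fun q : A × A => γ * dist q.2 0 * dist q.1 p.1
      + γ * dist p.1 0 * dist q.2 p.2) := by fun_prop
    simpa using this.tendsto p
  refine squeeze_zero (fun _ => dist_nonneg) (fun q => ?_) hlim
  exact (dist_triangle _ (p.1 * q.2) _).trans (add_le_add (h3 _ _ _) (h4 _ _ _))

theorem uniformContinuousConstSMul (h : IsMetricAlgebra ν A) : UniformContinuousConstSMul F A := by
  obtain ⟨γ, h0, -, h2, -⟩ := h.exists_const
  refine ⟨fun r => ?_⟩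
  have hr : 0 ≤ γ * ν r := mul_nonneg h0.le (apply_nonneg ν r)
  exact (LipschitzWith.of_dist_le_mul (K := ⟨γ * ν r, hr⟩) fun a b => h2 r a b).uniformContinuous

/-- The completion `C(A)` of a metric algebra: its completion as a metric space, with the
operations extended by continuity. -/
def Completion (_h : IsMetricAlgebra ν A) : Type _ := UniformSpace.Completion A

variable (h : IsMetricAlgebra ν A)

noncomputable instance : MetricSpace h.Completion :=
  inferInstanceAs (MetricSpace (UniformSpace.Completion A))

instance : CompleteSpace h.Completion :=
  inferInstanceAs (CompleteSpace (UniformSpace.Completion A))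

noncomputable instance : AddCommGroup h.Completion :=
  haveI := h.isUniformAddGroup
  inferInstanceAs (AddCommGroup (UniformSpace.Completion A))

noncomputable instance : Module F h.Completion :=
  haveI := h.isUniformAddGroup
  haveI := h.uniformContinuousConstSMul
  inferInstanceAs (Module F (UniformSpace.Completion A))

/-- The inclusion of a metric algebra into its completion. -/
def toCompletion (a : A) : h.Completion := (a : UniformSpace.Completion A)

theorem isometry_toCompletion : Isometry h.toCompletion :=
  UniformSpace.Completion.coe_isometry

theorem denseRange_toCompletion : DenseRange h.toCompletion :=
  UniformSpace.Completion.denseRange_coe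

theorem isDenseInducing_toCompletion : IsDenseInducing h.toCompletion :=
  UniformSpace.Completion.isDenseInducing_coe

theorem toCompletion_zero : h.toCompletion 0 = 0 := rfl

theorem toCompletion_add (a b : A) :
    h.toCompletion (a + b) = h.toCompletion a + h.toCompletion b :=
  haveI := h.isUniformAddGroup
  UniformSpace.Completion.coe_add a b

theorem toCompletion_smul (r : F) (a : A) :
    h.toCompletion (r • a) = r • h.toCompletion a :=
  haveI := h.uniformContinuousConstSMul
  UniformSpace.Completion.coe_smul r a

/-- Multiplication on the completion, extended by continuity from `A × A`. -/
noncomputable instance : Mul h.Completion where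
  mul x y := (h.isDenseInducing_toCompletion.prodMap h.isDenseInducing_toCompletion).extend
    (fun p : A × A => h.toCompletion (p.1 * p.2)) (x, y)

theorem toCompletion_mul (a b : A) :
    h.toCompletion (a * b) = h.toCompletion a * h.toCompletion b :=
  haveI := h.continuousMul
  ((h.isDenseInducing_toCompletion.prodMap h.isDenseInducing_toCompletion).extend_eq
    (f := fun p : A × A => h.toCompletion (p.1 * p.2))
    (h.isometry_toCompletion.continuous.comp continuous_mul) (a, b)).symm

instance : IsUniformAddGroup h.Completion :=
  haveI := h.isUniformAddGroup
  inferInstanceAs (IsUniformAddGroup (UniformSpace.Completion A))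

instance : ContinuousMul h.Completion where
  continuous_mul := by
    have := h.isUniformAddGroup
    have := h.continuousMul
    let e : A →+ h.Completion := ⟨⟨h.toCompletion, h.toCompletion_zero⟩, h.toCompletion_add⟩
    let m := (AddMonoidHom.mul : A →+ A →+ A).compr₂ e
    have hm : Continuous fun p : A × A => m p.1 p.2 :=
      h.isometry_toCompletion.continuous.comp continuous_mul
    have di : IsDenseInducing (e : A → h.Completion) := h.isDenseInducing_toCompletion
    exact (di.extend_Z_bilin di hm :)

/-- An identity between continuous functions of three variables extends to the completion. -/
theorem completion_ext₃ {f g : h.Completion × h.Completion × h.Completion → h.Completion}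
    (hf : Continuous f) (hg : Continuous g)
    (hfg : ∀ a b c : A, f (h.toCompletion a, h.toCompletion b, h.toCompletion c) =
      g (h.toCompletion a, h.toCompletion b, h.toCompletion c)) (x y z : h.Completion) :
    f (x, y, z) = g (x, y, z) :=
  h.denseRange_toCompletion.induction_on₃ (p := fun x y z => f (x, y, z) = g (x, y, z))
    (isClosed_eq hf hg) hfg x y z

theorem completion_zero_mul (x : h.Completion) : 0 * x = 0 := by
  refine h.completion_ext₃ (f := fun p => 0 * p.1) (g := fun _ => 0)
    (by fun_prop) (by fun_prop) (fun a _ _ => ?_) x 0 0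
  dsimp only
  rw [← h.toCompletion_zero, ← h.toCompletion_mul, zero_mul]

theorem completion_mul_zero (x : h.Completion) : x * 0 = 0 := by
  refine h.completion_ext₃ (f := fun p => p.1 * 0) (g := fun _ => 0)
    (by fun_prop) (by fun_prop) (fun a _ _ => ?_) x 0 0
  dsimp only
  rw [← h.toCompletion_zero, ← h.toCompletion_mul, mul_zero]

theorem completion_mul_assoc (x y z : h.Completion) : x * y * z = x * (y * z) := by
  refine h.completion_ext₃ (f := fun p => p.1 * p.2.1 * p.2.2)
    (g := fun p => p.1 * (p.2.1 * p.2.2)) (by fun_prop) (by fun_prop) (fun a b c => ?_) x y z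
  dsimp only
  rw [← h.toCompletion_mul, ← h.toCompletion_mul, ← h.toCompletion_mul, ← h.toCompletion_mul,
    mul_assoc]

theorem completion_mul_add (x y z : h.Completion) : x * (y + z) = x * y + x * z := by
  refine h.completion_ext₃ (f := fun p => p.1 * (p.2.1 + p.2.2))
    (g := fun p => p.1 * p.2.1 + p.1 * p.2.2) (by fun_prop) (by fun_prop) (fun a b c => ?_) x y z
  dsimp only
  rw [← h.toCompletion_add, ← h.toCompletion_mul, ← h.toCompletion_mul, ← h.toCompletion_mul,
    ← h.toCompletion_add, mul_add]

theorem completion_add_mul (x y z : h.Completion) : (x + y) * z = x * z + y * z := by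
  refine h.completion_ext₃ (f := fun p => (p.1 + p.2.1) * p.2.2)
    (g := fun p => p.1 * p.2.2 + p.2.1 * p.2.2) (by fun_prop) (by fun_prop)
    (fun a b c => ?_) x y z
  dsimp only
  rw [← h.toCompletion_add, ← h.toCompletion_mul, ← h.toCompletion_mul, ← h.toCompletion_mul,
    ← h.toCompletion_add, add_mul]

noncomputable instance : NonUnitalRing h.Completion :=
  { (inferInstance : AddCommGroup h.Completion), (inferInstance : Mul h.Completion) with
    zero_mul := h.completion_zero_mul
    mul_zero := h.completion_mul_zero
    mul_assoc := h.completion_mul_assoc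
    left_distrib := h.completion_mul_add
    right_distrib := h.completion_add_mul }

end IsMetricAlgebra

/-! The complete space `C(A_e)` is the union over `n` of the closed sets where `x ^ (n + 1) = 0`. By
Baire one of them has interior, which by density contains some `a` in `A_e`. For any `b` in `A_e`
the points `a + b / k` lie there for large `k`, so the polynomial `(a + t b) ^ (n + 1)` vanishes at
infinitely many scalars, and so does its top coefficient `b ^ (n + 1)`. Thus `A_e` is nil of bounded
index (`IsMetricAlgebra.exists_bounded_index`), hence nilpotent by Nagata–Higman
(`nagata_higman_mod`).

In a long nonzero product of homogeneous elements the initial products take finitely many degrees,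
so one degree recurs often. By cancellation each block between two recurrences has neutral degree,
which yields a long product in `A_e` (`IsGrading.isNilpotentAlgebra`). -/

/-! ### Polarization of powers. -/

section Polarization

variable {F R : Type*} [Field F] [Ring R] [Algebra F R]

/-- If a polynomial with coefficients in a vector space takes values in a subspace at infinitely
many scalars, then its coefficients lie in that subspace. -/
theorem Submodule.coeff_mem_of_infinite {M : Type*} [AddCommGroup M] [Module F M]
    (J : Submodule F M) (c : ℕ → M) (n : ℕ) {T : Set F} (hT : T.Infinite)
    (h : ∀ t ∈ T, ∑ k ∈ Finset.range (n + 1), t ^ k • c k ∈ J) {k : ℕ} (hk : k ≤ n) :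
    c k ∈ J := by
  -- Linear functionals on `M ⧸ J` reduce the claim to scalar polynomials with infinitely many
  -- roots.
  rw [← Submodule.Quotient.mk_eq_zero, ← Module.forall_dual_apply_eq_zero_iff F]
  intro f
  let g : M →ₗ[F] F := f ∘ₗ J.mkQ
  let q : Polynomial F := ∑ k ∈ Finset.range (n + 1), Polynomial.C (g (c k)) * Polynomial.X ^ k
  have hq : q = 0 := by
    refine Polynomial.eq_zero_of_infinite_isRoot q (hT.mono fun t ht => ?_)
    have h0 : g (∑ k ∈ Finset.range (n + 1), t ^ k • c k) = 0 := by
      change f (J.mkQ _) = 0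
      rw [(J.mkQ_apply _).trans ((Submodule.Quotient.mk_eq_zero J).2 (h t ht)), map_zero]
    rw [map_sum] at h0
    change q.eval t = 0
    rw [Polynomial.eval_finsetSum, ← h0]
    refine Finset.sum_congr rfl fun k _ => ?_
    simp [mul_comm (g (c k))]
  have hc := congrArg (fun p => Polynomial.coeff p k) hq
  simpa [q, Polynomial.finsetSum_coeff, Polynomial.coeff_C_mul, Polynomial.coeff_X_pow,
    Nat.lt_succ_iff, hk, g] using hc

/-- The sum of all words of length `n` with `k` letters `y` and `n - k` letters `x`: the coefficient
of `t ^ k` in `(x + t • y) ^ n`. -/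
def shuffleSum (x y : R) : ℕ → ℕ → R
  | 0, 0 => 1
  | 0, _ + 1 => 0
  | n + 1, 0 => shuffleSum x y n 0 * x
  | n + 1, k + 1 => shuffleSum x y n (k + 1) * x + shuffleSum x y n k * y

theorem shuffleSum_of_lt (x y : R) {n k : ℕ} (h : n < k) : shuffleSum x y n k = 0 := by
  induction n generalizing k with
  | zero => obtain ⟨k, rfl⟩ := Nat.exists_eq_succ_of_ne_zero h.ne'; rfl
  | succ n ih =>
    obtain ⟨k, rfl⟩ := Nat.exists_eq_succ_of_ne_zero (by lia : k ≠ 0)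
    simp [shuffleSum, ih (by lia : n < k + 1), ih (by lia : n < k)]

theorem shuffleSum_zero_right (x y : R) (n : ℕ) : shuffleSum x y n 0 = x ^ n := by
  induction n with
  | zero => simp [shuffleSum]
  | succ n ih => simp [shuffleSum, ih, pow_succ]

theorem shuffleSum_self (x y : R) (n : ℕ) : shuffleSum x y n n = y ^ n := by
  induction n with
  | zero => simp [shuffleSum]
  | succ n ih => simp [shuffleSum, ih, pow_succ, shuffleSum_of_lt x y (Nat.lt_succ_self n)]

theorem shuffleSum_one_right (x y : R) (n : ℕ) :
    shuffleSum x y (n + 1) 1 = ∑ i ∈ Finset.range (n + 1), x ^ i * y * x ^ (n - i) := by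
  induction n with
  | zero => simp [shuffleSum]
  | succ n ih =>
    rw [shuffleSum, ih, shuffleSum_zero_right, Finset.sum_range_succ _ (n + 1), Finset.sum_mul]
    simp only [Nat.sub_self, pow_zero, mul_one, add_left_inj]
    refine Finset.sum_congr rfl fun i hi => ?_
    rw [Nat.succ_sub (Nat.lt_succ_iff.1 (Finset.mem_range.1 hi)), pow_succ, mul_assoc _ _ x]

theorem add_smul_pow (x y : R) (t : F) (n : ℕ) :
    (x + t • y) ^ n = ∑ k ∈ Finset.range (n + 1), t ^ k • shuffleSum x y n k := by
  induction n with
  | zero => simp [shuffleSum]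
  | succ n ih =>
    have h1 : ∑ k ∈ Finset.range (n + 1), t ^ k • (shuffleSum x y n k * x) =
        shuffleSum x y n 0 * x +
          ∑ k ∈ Finset.range (n + 1), t ^ (k + 1) • (shuffleSum x y n (k + 1) * x) := by
      rw [Finset.sum_range_succ' _ n, Finset.sum_range_succ _ n,
        shuffleSum_of_lt x y (Nat.lt_succ_self n)]
      simp [add_comm]
    simp only [pow_succ (x + t • y), ih, mul_add, Finset.sum_mul, smul_mul_assoc, h1,
      Finset.sum_range_succ' _ (n + 1), shuffleSum, smul_add, Finset.sum_add_distrib, pow_zero,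
      one_smul, mul_smul_comm, Finset.smul_sum, smul_smul, ← pow_succ']
    abel

end Polarization

/-! ### The Nagata–Higman theorem. -/

section NagataHigman

variable {F R : Type*} [Field F] [CharZero F] [Ring R] [Algebra F R]

/-- This sum is the coefficient of `t` in `(x + t • y) ^ (n + 1)`, and `F` is infinite. -/
theorem sum_pow_mul_mul_pow_mem {N J : Submodule F R} {n : ℕ} (h : ∀ x ∈ N, x ^ (n + 1) ∈ J)
    {x y : R} (hx : x ∈ N) (hy : y ∈ N) :
    ∑ i ∈ Finset.range (n + 1), x ^ i * y * x ^ (n - i) ∈ J := by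
  rw [← shuffleSum_one_right]
  refine J.coeff_mem_of_infinite (shuffleSum x y (n + 1)) (n + 1) (T := Set.univ)
    Set.infinite_univ (fun t _ => ?_) (by lia)
  rw [← add_smul_pow]
  exact h _ (N.add_mem hx (N.smul_mem t hy))

/-- Higman's identity: `x ^ n * z * y ^ n` is in the ideal generated by the powers with exponent
`n + 1`. -/
theorem pow_mul_mul_pow_mem {N J : Submodule F R} (hN : ⊤ * N ≤ N) (hN' : N * ⊤ ≤ N)
    (hJ : ⊤ * J ≤ J) (hJ' : J * ⊤ ≤ J) {n : ℕ} (h : ∀ x ∈ N, x ^ (n + 1) ∈ J)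
    {x y z : R} (hx : x ∈ N) (hy : y ∈ N) (hz : z ∈ N) : x ^ n * z * y ^ n ∈ J := by
  have hl : ∀ (r : R) {s : R}, s ∈ J → r * s ∈ J := fun r s hs =>
    hJ (Submodule.mul_mem_mul Submodule.mem_top hs)
  have hr : ∀ (r : R) {s : R}, s ∈ J → s * r ∈ J := fun r s hs =>
    hJ' (Submodule.mul_mem_mul hs Submodule.mem_top)
  -- Double counting: for fixed `j` the sum over `i` is a linearized power of `x` around `z * y ^
  -- j`. For fixed `i < n` the sum over `j` is one of `y` around `x ^ (n - i)`, which lies in `N`.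
  -- What remains is `i = n`, namely `n + 1` copies of the target.
  let w : ℕ → ℕ → R := fun i j => x ^ i * z * y ^ j * x ^ (n - i) * y ^ (n - j)
  have h1 : ∑ j ∈ Finset.range (n + 1), ∑ i ∈ Finset.range (n + 1), w i j ∈ J := by
    refine J.sum_mem fun j _ => ?_
    have := hr (y ^ (n - j)) (sum_pow_mul_mul_pow_mem h hx
      (hN' (Submodule.mul_mem_mul hz (Submodule.mem_top (x := y ^ j)))))
    simpa only [Finset.sum_mul, w, mul_assoc] using this
  rw [Finset.sum_comm, Finset.sum_range_succ] at h1
  have h2 : ∑ i ∈ Finset.range n, ∑ j ∈ Finset.range (n + 1), w i j ∈ J := by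
    refine J.sum_mem fun i hi => ?_
    have hxi : x ^ (n - i) ∈ N := by
      obtain ⟨k, hk⟩ := Nat.exists_eq_succ_of_ne_zero
        (Nat.sub_ne_zero_of_lt (Finset.mem_range.1 hi))
      rw [hk, pow_succ]
      exact hN (Submodule.mul_mem_mul Submodule.mem_top hx)
    have := hl (x ^ i * z) (sum_pow_mul_mul_pow_mem h hy hxi)
    simpa only [Finset.mul_sum, w, mul_assoc] using this
  have h3 : ∑ j ∈ Finset.range (n + 1), w n j = ((n : F) + 1) • (x ^ n * z * y ^ n) := by
    rw [Finset.sum_congr rfl fun j hj => show w n j = x ^ n * z * y ^ n by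
      simp only [w, Nat.sub_self, pow_zero, mul_one]
      rw [mul_assoc _ (y ^ j), ← pow_add,
        Nat.add_sub_cancel' (Nat.lt_succ_iff.1 (Finset.mem_range.1 hj))]]
    rw [Finset.sum_const, Finset.card_range, ← Nat.cast_smul_eq_nsmul F]
    simp
  rw [h3] at h1
  exact (J.smul_mem_iff (Nat.cast_add_one_ne_zero n)).1 ((J.add_mem_iff_right h2).1 h1)

/-- The Nagata–Higman theorem, relative to an ideal `J`. -/
theorem nagata_higman_mod {N : Submodule F R} (hN : ⊤ * N ≤ N) (hN' : N * ⊤ ≤ N) (n : ℕ) :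
    ∀ J : Submodule F R, ⊤ * J ≤ J → J * ⊤ ≤ J → (∀ x ∈ N, x ^ n ∈ J) → ∃ m, N ^ m ≤ J := by
  induction n with
  | zero =>
    intro J _ _ h
    refine ⟨0, ?_⟩
    rw [pow_zero, Submodule.one_le]
    simpa using h 0 N.zero_mem
  | succ n ih =>
    intro J hJ hJ' h
    -- Modulo the ideal `I = ⊤ * P * ⊤` the index drops to `n`, and Higman's identity gives `I * N *
    -- I ≤ J`. So `N ^ m ≤ J ⊔ I` implies `N ^ m * N * N ^ m ≤ J`.
    let P : Submodule F R := Submodule.span F ((fun x => x ^ n) '' (N : Set R))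
    have hP : P * N * P ≤ J := by
      have hNs : N = Submodule.span F (N : Set R) := (Submodule.span_eq N).symm
      rw [hNs, Submodule.span_mul_span, Submodule.span_mul_span, Submodule.span_le]
      rintro _ ⟨_, ⟨_, ⟨x, hx, rfl⟩, z, hz, rfl⟩, _, ⟨y, hy, rfl⟩, rfl⟩
      exact pow_mul_mul_pow_mem hN hN' hJ hJ' h hx hy hz
    obtain ⟨m, hm⟩ := ih (J ⊔ ⊤ * P * ⊤)
      (by
        rw [Submodule.mul_sup, ← mul_assoc, ← mul_assoc]
        exact sup_le_sup hJ (by gcongr; exact le_top))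
      (by
        rw [Submodule.sup_mul, mul_assoc (⊤ * P)]
        exact sup_le_sup hJ' (by gcongr; exact le_top))
      (fun x hx => Submodule.mem_sup_right <| by
        have := Submodule.mul_mem_mul (Submodule.mul_mem_mul (Submodule.mem_top (x := (1 : R)))
          (Submodule.subset_span (R := F) (Set.mem_image_of_mem (fun x => x ^ n) hx)))
          (Submodule.mem_top (R := F) (x := (1 : R)))
        simpa using this)
    refine ⟨m + 1 + m, ?_⟩
    have hJl : ∀ K : Submodule F R, K * J ≤ J := fun K => (mul_le_mul_left le_top J).trans hJ
    have hJr : ∀ K : Submodule F R, J * K ≤ J := fun K => (mul_le_mul_right le_top J).trans hJ'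
    calc N ^ (m + 1 + m) = N ^ m * N * N ^ m := by rw [pow_add, pow_succ]
      _ ≤ (J ⊔ ⊤ * P * ⊤) * N * (J ⊔ ⊤ * P * ⊤) := by gcongr
      _ ≤ J := by
        rw [Submodule.sup_mul, Submodule.sup_mul, Submodule.mul_sup (⊤ * P * ⊤ * N)]
        refine sup_le ((mul_assoc J N _).le.trans (hJr _)) (sup_le (hJl _) ?_)
        calc ⊤ * P * ⊤ * N * (⊤ * P * ⊤) = ⊤ * (P * (⊤ * N * ⊤) * P) * ⊤ := by
              simp only [mul_assoc]
          _ ≤ ⊤ * (P * N * P) * ⊤ := by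
              gcongr
              exact (mul_le_mul_left hN ⊤).trans hN'
          _ ≤ ⊤ * J * ⊤ := by gcongr
          _ ≤ J := (hJr _).trans' (by gcongr)

end NagataHigman

/-! ### Products of sequences. -/

section SeqProd

open scoped Pointwise

theorem map_seqProd {A B : Type*} [Mul A] [Mul B] (f : A → B) (hf : ∀ x y, f (x * y) = f x * f y)
    (a : ℕ → A) (n : ℕ) : f (seqProd a n) = seqProd (fun i => f (a i)) n := by
  induction n with
  | zero => rfl
  | succ n ih => rw [seqProd, hf, ih, seqProd]

theorem seqProd_const {M : Type*} [Monoid M] (x : M) (n : ℕ) :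
    seqProd (fun _ => x) n = x ^ (n + 1) := by
  induction n with
  | zero => simp [seqProd]
  | succ n ih => rw [seqProd, ih, ← pow_succ]

theorem seqProd_add {M : Type*} [Semigroup M] (a : ℕ → M) (m n : ℕ) :
    seqProd a (m + 1 + n) = seqProd a m * seqProd (fun i => a (m + 1 + i)) n := by
  induction n with
  | zero => rfl
  | succ n ih => rw [← add_assoc, seqProd, ih, mul_assoc]; rfl

theorem seqProd_congr {M : Type*} [Mul M] {a b : ℕ → M} {n : ℕ} (h : ∀ i ≤ n, a i = b i) :
    seqProd a n = seqProd b n := by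
  induction n with
  | zero => exact h 0 le_rfl
  | succ n ih => rw [seqProd, seqProd, ih fun i hi => h i (by lia), h _ le_rfl]

theorem Set.exists_seqProd_of_mem_pow {M : Type*} [Monoid M] {G : Set M} {n : ℕ} {x : M}
    (hx : x ∈ G ^ (n + 1)) : ∃ b : ℕ → M, (∀ i, b i ∈ G) ∧ seqProd b n = x := by
  induction n generalizing x with
  | zero => exact ⟨fun _ => x, fun _ => by simpa using hx, rfl⟩
  | succ n ih =>
    rw [pow_succ] at hx
    obtain ⟨y, hy, z, hz, rfl⟩ := hx
    obtain ⟨b, hb, rfl⟩ := ih hy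
    -- Position `n + 1` receives the last factor; later values do not enter the product.
    refine ⟨fun i => if i ≤ n then b i else z, fun i => ?_, ?_⟩
    · dsimp only
      split_ifs
      exacts [hb i, hz]
    · rw [seqProd, seqProd_congr (b := b) fun i hi => if_pos hi]
      simp

theorem Submodule.seqProd_mem_pow {F R : Type*} [Field F] [Ring R] [Algebra F R]
    {N : Submodule F R} {a : ℕ → R} (h : ∀ i, a i ∈ N) (n : ℕ) : seqProd a n ∈ N ^ (n + 1) := by
  induction n with
  | zero => simpa [seqProd] using h 0
  | succ n ih => rw [pow_succ]; exact Submodule.mul_mem_mul ih (h _)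

theorem seqProd_eq_zero_of_le {A : Type*} [NonUnitalRing A] {a : ℕ → A} {m n : ℕ} (hmn : m ≤ n)
    (h : seqProd a m = 0) : seqProd a n = 0 := by
  induction n, hmn using Nat.le_induction with
  | base => exact h
  | succ n _ ih => rw [seqProd, ih, zero_mul]

end SeqProd

/-! ### From bounded index to nilpotency. -/

section Nilpotent

variable {F A : Type*} [Field F] [NonUnitalRing A] [Module F A]

theorem inr_seqProd (a : ℕ → A) (n : ℕ) :
    (Unitization.inr (seqProd a n) : Unitization F A) =
      seqProd (fun i => (Unitization.inr (a i) : Unitization F A)) n :=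
  map_seqProd _ (Unitization.inr_mul F) a n

/-- A nil algebra of bounded index in characteristic zero is nilpotent. -/
theorem isNilpotentAlgebra_of_bounded_index [CharZero F] [IsScalarTower F A A]
    [SMulCommClass F A A] (n : ℕ)
    (h : ∀ a : A, seqProd (fun _ => a) n = 0) : IsNilpotentAlgebra A := by
  -- In the unitization `A` is a two-sided ideal, the kernel of the scalar part.
  let N : Submodule F (Unitization F A) := LinearMap.range (Unitization.inrHom F F A)
  have hmem : ∀ x : Unitization F A, x ∈ N ↔ x.fst = 0 := fun x =>
    ⟨fun ⟨a, ha⟩ => by rw [← ha]; simp, fun hx => ⟨x.snd, by ext <;> simp [hx]⟩⟩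
  obtain ⟨m, hm⟩ := nagata_higman_mod (N := N)
    (Submodule.mul_le.2 fun x _ y hy => by simp_all)
    (Submodule.mul_le.2 fun x hx y _ => by simp_all) (n + 1) ⊥ (by simp) (by simp)
    (by
      rintro _ ⟨a, rfl⟩
      have := inr_seqProd (F := F) (fun _ => a) n
      rw [h a, seqProd_const] at this
      simpa using this.symm)
  refine ⟨m, fun a => Unitization.inr_injective (R := F) ?_⟩
  have h1 : (Unitization.inr (seqProd a m) : Unitization F A) ∈ N ^ (m + 1) := by
    rw [inr_seqProd]
    exact Submodule.seqProd_mem_pow (N := N) (fun i => ⟨a i, rfl⟩) m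
  rw [pow_succ, le_bot_iff.1 hm, Submodule.bot_mul, Submodule.mem_bot] at h1
  simpa using h1

end Nilpotent

/-- This locates a visit with exactly `c` earlier visits, so recurrences of a degree can be traced
back one at a time. -/
theorem Nat.exists_lt_count_eq {p : ℕ → Prop} [DecidablePred p] {c n : ℕ}
    (h : c < Nat.count p n) : ∃ j < n, p j ∧ Nat.count p j = c := by
  have hc : ∀ hf : (Set.ofPred p).Finite, c < hf.toFinset.card := fun hf =>
    h.trans_le (Nat.count_le_card hf n)
  exact ⟨Nat.nth p c, Nat.nth_lt_of_lt_count h, Nat.nth_mem c hc, Nat.count_nth hc⟩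

/-! ### Finite gradings and the pigeonhole argument. -/

section Grading

open scoped Pointwise

variable {F S A : Type*} [Field F] [LeftCancelMonoid S] [NonUnitalRing A] [Module F A]
  {𝒜 : S → Submodule F A}

theorem IsGrading.seqProd_mem (h𝒜 : IsGrading 𝒜) {a : ℕ → A} {s : ℕ → S}
    (ha : ∀ i, a i ∈ 𝒜 (s i)) (n : ℕ) : seqProd a n ∈ 𝒜 (seqProd s n) := by
  induction n with
  | zero => exact ha 0
  | succ n ih => exact h𝒜.mul_mem _ _ _ _ ih (ha _)

/-- If many partial products of a homogeneous sequence have the same degree, then the product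
has a tail consisting of many consecutive factors of neutral degree. -/
theorem IsGrading.inr_seqProd_mem_top_mul_pow [IsScalarTower F A A] [SMulCommClass F A A]
    (h𝒜 : IsGrading 𝒜) {a : ℕ → A} {s : ℕ → S}
    (ha : ∀ i, a i ∈ 𝒜 (s i)) (y : S) [DecidablePred fun i => seqProd s i = y] (c : ℕ) {i : ℕ}
    (hi : seqProd s i = y) (hc : c ≤ Nat.count (fun i => seqProd s i = y) i) :
    (Unitization.inr (seqProd a i) : Unitization F A) ∈
      (⊤ : Submodule F (Unitization F A)) * ((𝒜 1).map (Unitization.inrHom F F A)) ^ c := by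
  induction c generalizing i with
  | zero => simp
  | succ c ih =>
    obtain ⟨j, hji, hj, hcj⟩ := Nat.exists_lt_count_eq hc
    obtain ⟨k, rfl⟩ := Nat.exists_eq_add_of_lt hji
    rw [add_right_comm] at hi ⊢
    -- Both initial products have degree `y`, so the block between them has a degree `d` with `y * d
    -- = y`.
    have h1 : seqProd (fun l => s (j + 1 + l)) k = 1 := by
      rw [seqProd_add, hj] at hi
      exact mul_eq_left.1 hi
    have h2 := h𝒜.seqProd_mem (a := fun l => a (j + 1 + l)) (fun l => ha _) k
    rw [h1] at h2
    rw [seqProd_add, Unitization.inr_mul, pow_succ, ← mul_assoc]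
    exact Submodule.mul_mem_mul (ih hj hcj.ge) ⟨_, h2, rfl⟩

/-- A finitely graded algebra whose neutral component is nilpotent is nilpotent. -/
theorem IsGrading.isNilpotentAlgebra [IsScalarTower F A A] [SMulCommClass F A A]
    (h𝒜 : IsGrading 𝒜) (hfin : {s : S | 𝒜 s ≠ ⊥}.Finite)
    (hnil : IsNilpotentAlgebra h𝒜.neutral) : IsNilpotentAlgebra A := by
  classical
  obtain ⟨m, hm⟩ := hnil
  let E : Submodule F (Unitization F A) := (𝒜 1).map (Unitization.inrHom F F A)
  have hE : E ^ (m + 1) = ⊥ := by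
    rw [← Submodule.span_eq E, Submodule.span_pow, Submodule.span_eq_bot]
    intro x hx
    obtain ⟨b, hb, rfl⟩ := Set.exists_seqProd_of_mem_pow hx
    choose e he hbe using hb
    have h0 := congrArg (Subtype.val : h𝒜.neutral → A) (hm fun i => ⟨e i, he i⟩)
    rw [map_seqProd (Subtype.val : h𝒜.neutral → A) fun _ _ => rfl] at h0
    rw [← funext hbe]
    exact (inr_seqProd e m).symm.trans ((congrArg _ h0).trans (Unitization.inr_zero F))
  -- The `n + 1` initial products exceed `m + 1` per degree of the support, so some degree has `m +
  -- 2` visits, with `m + 1` neutral blocks between them.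
  let n := hfin.toFinset.card * (m + 1)
  have key : ∀ (a : ℕ → A) (s : ℕ → S), (∀ i, a i ∈ 𝒜 (s i)) → seqProd a n = 0 := by
    intro a s ha
    by_contra hne
    obtain ⟨y, -, hy⟩ := Finset.exists_lt_card_fiber_of_mul_lt_card_of_maps_to
      (s := Finset.range (n + 1)) (t := hfin.toFinset) (f := seqProd s) (n := m + 1)
      (fun i hi => by
        rw [Set.Finite.mem_toFinset]
        intro hbot
        have h0 := h𝒜.seqProd_mem ha i
        rw [hbot, Submodule.mem_bot] at h0
        exact hne (seqProd_eq_zero_of_le (Nat.lt_succ_iff.1 (Finset.mem_range.1 hi)) h0))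
      (by simp [n])
    rw [← Nat.count_eq_card_filter_range] at hy
    obtain ⟨j, hjn, hj, hcj⟩ := Nat.exists_lt_count_eq hy
    have h1 := h𝒜.inr_seqProd_mem_top_mul_pow ha y (m + 1) hj hcj.ge
    rw [show ((𝒜 1).map (Unitization.inrHom F F A)) ^ (m + 1) = ⊥ from hE, Submodule.mul_bot,
      Submodule.mem_bot] at h1
    exact hne (seqProd_eq_zero_of_le (Nat.lt_succ_iff.1 hjn)
      (Unitization.inr_injective (R := F) (h1.trans (Unitization.inr_zero F).symm)))
  -- Homogeneous elements span, so by multilinearity it suffices that their products vanish.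
  let H : Set (Unitization F A) := ⋃ s, Unitization.inrHom F F A '' (𝒜 s : Set A)
  have hH : ∀ c : A, (Unitization.inr c : Unitization F A) ∈ Submodule.span F H := by
    intro c
    have hc : c ∈ ⨆ s, 𝒜 s := by
      rw [h𝒜.isInternal.submodule_iSup_eq_top]
      trivial
    have hle : ⨆ s, 𝒜 s ≤ (Submodule.span F H).comap (Unitization.inrHom F F A) :=
      iSup_le fun s x hx => Submodule.subset_span (Set.mem_iUnion.2 ⟨s, x, hx, rfl⟩)
    exact hle hc
  refine ⟨n, fun a => Unitization.inr_injective (R := F) ?_⟩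
  have h1 := Submodule.seqProd_mem_pow (fun i => hH (a i)) n
  rw [← inr_seqProd, Submodule.span_pow] at h1
  have hbot : Submodule.span F (H ^ (n + 1)) = ⊥ := by
    rw [Submodule.span_eq_bot]
    intro x hx
    obtain ⟨b, hb, rfl⟩ := Set.exists_seqProd_of_mem_pow hx
    choose s e he hbe using fun i => Set.mem_iUnion.1 (hb i)
    rw [← funext hbe]
    exact (inr_seqProd e n).symm.trans
      ((congrArg _ (key e s he)).trans (Unitization.inr_zero F))
  rw [hbot, Submodule.mem_bot] at h1
  exact h1.trans (Unitization.inr_zero F).symm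

end Grading

/-! ### Bounded index by Baire category. -/

section Baire

variable {F : Type*} [Field F] [CharZero F] {ν : RingNorm F}
  {A : Type*} [NonUnitalRing A] [Module F A] [MetricSpace A]

/-- Submultiplicativity alone does not bound inverses from above; here `|n • x| = n * |x|` at `x = 1
/ k` makes `1 / k` tend to `0`. -/
theorem IsNormedFieldNorm.apply_inv_natCast (hν : IsNormedFieldNorm ν) {k : ℕ} (hk : k ≠ 0) :
    ν ((k : F)⁻¹) = ν 1 / k := by
  have h := hν.natCast_mul inferInstance k ((k : F)⁻¹)
  have hk' : (k : F) ≠ 0 := Nat.cast_ne_zero.2 hk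
  rw [nsmul_eq_mul, mul_inv_cancel₀ hk'] at h
  rw [h, mul_div_cancel_left₀ _ (Nat.cast_ne_zero.2 hk)]

theorem IsMetricAlgebra.tendsto_inv_natCast_smul (hν : IsNormedFieldNorm ν)
    (hA : IsMetricAlgebra ν A) (b : A) :
    Filter.Tendsto (fun k : ℕ => (k : F)⁻¹ • b) Filter.atTop (nhds 0) := by
  obtain ⟨γ, -, -, h2, -⟩ := hA.exists_const
  rw [tendsto_iff_dist_tendsto_zero]
  refine squeeze_zero' (g := fun k : ℕ => γ * (ν 1 / k) * dist b 0)
    (Filter.Eventually.of_forall fun _ => dist_nonneg) ?_ ?_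
  · filter_upwards [Filter.eventually_ne_atTop 0] with k hk
    simpa [hν.apply_inv_natCast hk] using h2 (k : F)⁻¹ b 0
  · simpa using ((tendsto_const_div_atTop_nhds_zero_nat (ν 1)).const_mul γ).mul_const (dist b 0)

/-- By Baire's theorem, a metric algebra with nil completion is nil of bounded index. -/
theorem IsMetricAlgebra.exists_bounded_index (hν : IsNormedFieldNorm ν)
    [IsScalarTower F A A] [SMulCommClass F A A] (hA : IsMetricAlgebra ν A)
    (hnil : IsNilAlgebra hA.Completion) :
    ∃ n, ∀ a : A, seqProd (fun _ => a) n = 0 := by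
  have := hA.isUniformAddGroup
  let Z : ℕ → Set hA.Completion := fun n => {x | seqProd (fun _ => x) n = 0}
  have hcont : ∀ n, Continuous fun x : hA.Completion => seqProd (fun _ => x) n := by
    intro n
    induction n with
    | zero => exact continuous_id
    | succ n ih => exact ih.mul continuous_id
  obtain ⟨n, hn⟩ := nonempty_interior_of_iUnion_of_closed (f := Z)
    (fun n => isClosed_eq (hcont n) continuous_const)
    (Set.iUnion_eq_univ_iff.2 hnil)
  obtain ⟨a, ha⟩ := hA.denseRange_toCompletion.exists_mem_open isOpen_interior hn
  refine ⟨n, fun b => ?_⟩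
  have hlim : Filter.Tendsto (fun k : ℕ => hA.toCompletion (a + (k : F)⁻¹ • b)) Filter.atTop
      (nhds (hA.toCompletion a)) := by
    refine (hA.isometry_toCompletion.continuous.tendsto a).comp ?_
    simpa using (hA.tendsto_inv_natCast_smul hν b).const_add a
  obtain ⟨K, hK⟩ := Filter.eventually_atTop.1 (hlim.eventually (isOpen_interior.mem_nhds ha))
  have hzero : ∀ k ≥ K, seqProd (fun _ => a + (k : F)⁻¹ • b) n = 0 := by
    intro k hk
    have h0 : seqProd (fun _ => hA.toCompletion (a + (k : F)⁻¹ • b)) n = 0 :=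
      interior_subset (s := Z n) (hK k hk)
    rw [← map_seqProd hA.toCompletion hA.toCompletion_mul, ← hA.toCompletion_zero] at h0
    exact hA.isometry_toCompletion.injective h0
  -- Characteristic zero makes the scalars `1 / k` distinct.
  have hinf : ((fun k : ℕ => (k : F)⁻¹) '' Set.Ici K).Infinite :=
    (Set.Ici_infinite K).image (inv_injective.comp Nat.cast_injective).injOn
  -- The coefficient extracted is the top one, `b ^ (n + 1)`; the exponent does not depend on `b`.
  have h1 := (⊥ : Submodule F (Unitization F A)).coeff_mem_of_infinite
    (shuffleSum (Unitization.inr a) (Unitization.inr b) (n + 1)) (n + 1) hinf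
    (by
      rintro _ ⟨k, hk, rfl⟩
      rw [← add_smul_pow, ← Unitization.inr_smul, ← Unitization.inr_add, ← seqProd_const,
        ← inr_seqProd, hzero k hk]
      simp) le_rfl
  rw [shuffleSum_self, ← seqProd_const, ← inr_seqProd, Submodule.mem_bot] at h1
  exact Unitization.inr_injective (R := F) (h1.trans (Unitization.inr_zero F).symm)

end Baire

theorem corollary2p6 {F S A : Type*} [Field F] [CharZero F] (ν : RingNorm F)
    (hν : IsNormedFieldNorm ν) [CancelMonoid S]
    [NonUnitalRing A] [Module F A] [IsScalarTower F A A] [SMulCommClass F A A] [MetricSpace A]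
    (hA : IsMetricAlgebra ν A)
    (𝒜 : S → Submodule F A) (h𝒜 : IsGrading 𝒜) (hfin : {s : S | 𝒜 s ≠ ⊥}.Finite)
    (hnil : IsNilAlgebra (hA.subalgebra h𝒜.neutral).Completion) :
    IsNilpotentAlgebra A := by
  obtain ⟨n, hn⟩ := (hA.subalgebra h𝒜.neutral).exists_bounded_index hν hnil
  exact h𝒜.isNilpotentAlgebra hfin (isNilpotentAlgebra_of_bounded_index (F := F) n hn)
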